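/- Let $M$ be a compact complex manifold of dimension $d$ (Hausdorff; connectedness is not needed) and let $L$ be a holomorphic line bundle on $M$. For an integer $k\ge 0$ write $kL=L^{\otimes k}$, and let $H^0(M,kL)$ be the complex vector space of global holomorphic sections of $kL$. Call $kL$ *spanned* (base-point free) if for every $x\in M$ there is $s\in H^0(M,kL)$ with $s(x)\neq 0$. Call $kL$ *very ample* if there are finitely many sections $s_0,\dots,s_N\in H^0(M,kL)$ without common zero such that the map $M\to\mathbb{P}^N(\mathbb{C})$, $x\mapsto[s_0(x):\dots:s_N(x)]$, is a holomorphic embedding, that is, it is holomorphic, a homeomorphism onto its image, and its differential is injective at every point. Call $L$ *ample* if $kL$ is very ample for some integer $k\ge 1$; the pair $(M,L)$ is then called a *polarized manifold*. For an integer $r\ge 1$ call $L$ *$r$-generated* if the graded algebra (without unit) $$G(M,L)=\bigoplus_{i\ge 1}H^0(M,iL),$$ whose product is the tensor product of sections, is generated as a $\mathbb{C}$-algebra by the sections in $H^0(M,L),\dots,H^0(M,rL)$. **Corollary.** Let $r\ge 1$ and let $(M,L)$ be a polarized manifold such that $L$ is spanned and $r$-generated. Then $rL$ is very ample. -/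

import Mathlib

open Bundle Set Topology
open scoped Manifold ContDiff TensorProduct LinearAlgebra.Projectivization

noncomputable section

namespace PolarizedManifold

/-! ### Complex projective space as a complex manifold -/

/-- Complex projective space `ℙⁿ`, the set of lines through the origin of `ℂⁿ⁺¹`. -/
def ProjSpace (n : ℕ) : Type := ℙ ℂ (Fin (n + 1) → ℂ)

namespace ProjSpace

variable {n : ℕ}

/-- The point `[v₀ : ⋯ : vₙ]` of `ℙⁿ`. -/
def mk (v : {v : Fin (n + 1) → ℂ // v ≠ 0}) : ProjSpace n := Projectivization.mk' ℂ v

theorem mk_surjective : Function.Surjective (mk (n := n)) := fun p =>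
  ⟨⟨Projectivization.rep p, Projectivization.rep_nonzero p⟩, Projectivization.mk_rep p⟩

theorem mk_eq_mk_iff (v w : {v : Fin (n + 1) → ℂ // v ≠ 0}) :
    mk v = mk w ↔ ∃ a : ℂ, a • w.1 = v.1 :=
  Projectivization.mk_eq_mk_iff' ℂ v.1 w.1 v.2 w.2

/-- The quotient topology. -/
instance : TopologicalSpace (ProjSpace n) := TopologicalSpace.coinduced mk inferInstance

theorem isQuotientMap_mk : IsQuotientMap (mk (n := n)) := ⟨⟨rfl⟩, mk_surjective⟩

/-- The affine coordinates `(v_j / v_i)_{j ≠ i}` of the point `[v₀ : ⋯ : vₙ]`. -/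
def affineCoord (i : Fin (n + 1)) (p : ProjSpace n) : Fin n → ℂ :=
  Projectivization.lift (K := ℂ) (V := Fin (n + 1) → ℂ)
    (fun v j => v.1 (i.succAbove j) / v.1 i) (by
    intro a b t h
    have ht : t ≠ 0 := by rintro rfl; exact a.2 (by simpa using h)
    funext j
    simp only [h, Pi.smul_apply, smul_eq_mul]
    exact mul_div_mul_left _ _ ht) p

/-- The set of points `[v₀ : ⋯ : vₙ]` with `v_i ≠ 0`. -/
def affineSet (i : Fin (n + 1)) : Set (ProjSpace n) := mk '' {v | v.1 i ≠ 0}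

/-- The point of `ℙⁿ` with `i`-th coordinate `1` and the other coordinates given by `w`. -/
def ofAffine (i : Fin (n + 1)) (w : Fin n → ℂ) : ProjSpace n :=
  mk ⟨i.insertNth (α := fun _ => ℂ) 1 w, fun h => by simpa using congrFun h i⟩

theorem affineCoord_mk (i : Fin (n + 1)) (v : {v : Fin (n + 1) → ℂ // v ≠ 0}) :
    affineCoord i (mk v) = fun j => v.1 (i.succAbove j) / v.1 i := rfl

theorem mk_mem_affineSet (i : Fin (n + 1)) (v : {v : Fin (n + 1) → ℂ // v ≠ 0}) :
    mk v ∈ affineSet i ↔ v.1 i ≠ 0 := by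
  constructor
  · rintro ⟨w, hw, h⟩
    obtain ⟨a, ha⟩ := (mk_eq_mk_iff w v).1 h
    intro h0
    exact hw (by rw [← ha]; simp [h0])
  · exact fun h => ⟨v, h, rfl⟩

theorem ofAffine_mem (i : Fin (n + 1)) (w : Fin n → ℂ) : ofAffine i w ∈ affineSet i :=
  (mk_mem_affineSet i _).2 (by simp)

theorem isOpen_affineSet (i : Fin (n + 1)) : IsOpen (affineSet (n := n) i) := by
  rw [← isQuotientMap_mk.isOpen_preimage]
  have : mk ⁻¹' affineSet (n := n) i = {v | v.1 i ≠ 0} := by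
    ext v; exact mk_mem_affineSet i v
  rw [this]
  exact isOpen_ne_fun ((continuous_apply i).comp continuous_subtype_val) continuous_const

/-- The standard affine chart `{v_i ≠ 0} ≃ ℂⁿ` of `ℙⁿ`. -/
def affineChart (i : Fin (n + 1)) : OpenPartialHomeomorph (ProjSpace n) (Fin n → ℂ) where
  toFun := affineCoord i
  invFun := ofAffine i
  source := affineSet i
  target := univ
  map_source' _ _ := mem_univ _
  map_target' w _ := ofAffine_mem i w
  left_inv' p hp := by
    obtain ⟨v, rfl⟩ := mk_surjective p
    have hv := (mk_mem_affineSet i v).1 hp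
    rw [affineCoord_mk, ofAffine, mk_eq_mk_iff]
    refine ⟨(v.1 i)⁻¹, ?_⟩
    funext j
    refine Fin.succAboveCases i ?_ (fun k => ?_) j
    · simp [hv]
    · simp [div_eq_inv_mul]
  right_inv' w _ := by
    rw [ofAffine, affineCoord_mk]
    funext j
    simp
  open_source := isOpen_affineSet i
  open_target := isOpen_univ
  continuousOn_toFun := by
    have hq := isQuotientMap_mk.restrictPreimage_isOpen (isOpen_affineSet (n := n) i)
    rw [continuousOn_iff_continuous_domRestrict, hq.continuous_iff]
    refine continuous_pi fun j => ?_
    have hc : ∀ k : Fin (n + 1),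
        Continuous fun x : (mk ⁻¹' affineSet (n := n) i : Set _) => x.1.1 k := fun k =>
      (continuous_apply k).comp (continuous_subtype_val.comp continuous_subtype_val)
    exact (hc _).div (hc i) fun x => (mk_mem_affineSet i _).1 x.2
  continuousOn_invFun := by
    refine Continuous.continuousOn ?_
    refine isQuotientMap_mk.continuous.comp (Continuous.subtype_mk ?_ _)
    exact Continuous.finInsertNth i continuous_const continuous_id

theorem exists_mem_affineSet (p : ProjSpace n) : ∃ i, p ∈ affineSet i := by
  obtain ⟨v, rfl⟩ := mk_surjective p
  obtain ⟨i, hi⟩ := Function.ne_iff.1 v.2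
  exact ⟨i, (mk_mem_affineSet i v).2 hi⟩

instance : ChartedSpace (Fin n → ℂ) (ProjSpace n) where
  atlas := range affineChart
  chartAt p := affineChart (exists_mem_affineSet p).choose
  mem_chart_source p := (exists_mem_affineSet p).choose_spec
  chart_mem_atlas _ := mem_range_self _

instance : IsManifold 𝓘(ℂ, Fin n → ℂ) ω (ProjSpace n) := by
  refine isManifold_of_contDiffOn _ _ _ ?_
  rintro _ _ ⟨i, rfl⟩ ⟨k, rfl⟩
  have hins : ∀ l : Fin (n + 1), ContDiff ℂ ω
      (fun w : Fin n → ℂ => (i.insertNth (α := fun _ => ℂ) 1 w : Fin (n + 1) → ℂ) l) := by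
    intro l
    refine Fin.succAboveCases i ?_ (fun j => ?_) l
    · simpa using contDiff_const
    · simpa using contDiff_apply ℂ ℂ j
  refine contDiffOn_pi.2 fun j => ?_
  refine ContDiffOn.div (hins _).contDiffOn (hins k).contDiffOn ?_
  intro w hw
  exact (mk_mem_affineSet k _).1 hw.1.2

end ProjSpace

/-! ### Holomorphic embeddings into projective space -/

section

variable {d : ℕ} {M : Type*} [TopologicalSpace M] [ChartedSpace (EuclideanSpace ℂ (Fin d)) M]

/-- A map from a complex manifold of dimension `d` to `ℙᴺ` is a holomorphic embedding if it is
holomorphic, a homeomorphism onto its image, and has injective differential at each point. -/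
structure IsHolomorphicEmbedding {N : ℕ} (φ : M → ProjSpace N) : Prop where
  holomorphic : ContMDiff 𝓘(ℂ, EuclideanSpace ℂ (Fin d)) 𝓘(ℂ, Fin N → ℂ) ω φ
  isEmbedding : IsEmbedding φ
  immersion : ∀ x : M, Function.Injective
    (mfderiv 𝓘(ℂ, EuclideanSpace ℂ (Fin d)) 𝓘(ℂ, Fin N → ℂ) φ x)

end

/-! ### Tensor powers of a line bundle and their holomorphic sections -/

section

variable {M : Type*} [TopologicalSpace M]
  {L : M → Type*} [∀ x, AddCommGroup (L x)] [∀ x, Module ℂ (L x)]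
  [∀ x, TopologicalSpace (L x)] [TopologicalSpace (TotalSpace ℂ L)]
  [FiberBundle ℂ L]

/-- The trivialization of the tensor power `L^{⊗k}` at `x` that a trivialization `e` of the line
bundle `L` induces: `v₁ ⊗ ⋯ ⊗ vₖ ↦ e(v₁) ⋯ e(vₖ)`, from the fibre `L_x^{⊗k}` to `ℂ`. -/
def tensorCoord (e : Trivialization ℂ (π ℂ L)) [e.IsLinear ℂ] (k : ℕ) (x : M) :
    (⨂[ℂ]^k (L x)) →ₗ[ℂ] ℂ :=
  PiTensorProduct.lift
    ((MultilinearMap.mkPiAlgebra ℂ (Fin k) ℂ).compLinearMap fun _ => e.linearMapAt ℂ x)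

theorem tensorCoord_tprod (e : Trivialization ℂ (π ℂ L)) [e.IsLinear ℂ] (k : ℕ) (x : M)
    (v : Fin k → L x) :
    tensorCoord e k x (PiTensorProduct.tprod ℂ v) = ∏ i, e.linearMapAt ℂ x (v i) := by
  simp [tensorCoord]

theorem tensorCoord_eq_lift (e : Trivialization ℂ (π ℂ L)) [e.IsLinear ℂ] (k : ℕ) (x : M)
    (a : ⨂[ℂ]^k (L x)) :
    tensorCoord e k x a =
      TensorAlgebra.lift ℂ (e.linearMapAt ℂ x) (TensorPower.toTensorAlgebra a) := by
  have h : tensorCoord e k x = (TensorAlgebra.lift ℂ (e.linearMapAt ℂ x)).toLinearMap ∘ₗ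
      TensorPower.toTensorAlgebra := by
    refine PiTensorProduct.ext (MultilinearMap.ext fun v => ?_)
    simp [tensorCoord_tprod, TensorAlgebra.tprod_apply, List.prod_ofFn, List.map_ofFn,
      map_list_prod]
  rw [h]; rfl

/-- Over the base set of `e`, the induced coordinate on the fibre of `L^{⊗k}` is injective. -/
theorem tensorCoord_injective (e : Trivialization ℂ (π ℂ L)) [e.IsLinear ℂ] (k : ℕ) {x : M}
    (hx : x ∈ e.baseSet) : Function.Injective (tensorCoord e k x) := by
  have h : tensorCoord e k x =
      (PiTensorProduct.congr (fun _ : Fin k => e.linearEquivAt ℂ x hx) ≪≫ₗ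
        (PiTensorProduct.constantBaseRingEquiv (Fin k) ℂ).toLinearEquiv).toLinearMap := by
    refine PiTensorProduct.ext (MultilinearMap.ext fun v => ?_)
    simp [tensorCoord_tprod, Trivialization.linearMapAt_apply, hx]
  rw [h]
  exact LinearEquiv.injective _

variable {d : ℕ} [ChartedSpace (EuclideanSpace ℂ (Fin d)) M] [VectorBundle ℂ ℂ L]

variable (L d) in
/-- `H⁰(M, kL)`: the space of global holomorphic sections of `L^{⊗k}`, that is of the families
`s(x) ∈ L_x^{⊗k}` that are holomorphic in every local trivialization of `L`. -/
def H0 (k : ℕ) : Submodule ℂ (∀ x, ⨂[ℂ]^k (L x)) where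
  carrier := {s | ∀ (e : Trivialization ℂ (π ℂ L)) [MemTrivializationAtlas e],
    ContMDiffOn 𝓘(ℂ, EuclideanSpace ℂ (Fin d)) 𝓘(ℂ, ℂ) ω
      (fun x => tensorCoord e k x (s x)) e.baseSet}
  add_mem' {s t} hs ht e _ := by
    simp only [Pi.add_apply, map_add]
    exact (hs e).add (ht e)
  zero_mem' e _ := by
    simp only [Pi.zero_apply, map_zero]
    exact contMDiffOn_const
  smul_mem' c s hs e _ := by
    simp only [Pi.smul_apply, map_smul, smul_eq_mul]
    exact contMDiffOn_const.mul (hs e)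

variable (L) in
/-- The inclusion of families `s(x) ∈ L_x^{⊗k}` into the algebra of families of elements of the
tensor algebras `⨁ₖ L_x^{⊗k}`, with pointwise operations. -/
def toTensorAlg (k : ℕ) : (∀ x, ⨂[ℂ]^k (L x)) →ₗ[ℂ] (∀ x, TensorAlgebra ℂ (L x)) :=
  LinearMap.pi fun x => TensorPower.toTensorAlgebra ∘ₗ LinearMap.proj x

variable (L d) in
/-- The products of sections of `iL` and `jL` are sections of `(i+j)L`. -/
theorem mul_mem_H0 {i j : ℕ} {s : ∀ x, ⨂[ℂ]^i (L x)} {t : ∀ x, ⨂[ℂ]^j (L x)}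
    (hs : s ∈ H0 L d i) (ht : t ∈ H0 L d j) :
    ∃ u ∈ H0 L d (i + j), toTensorAlg L (i + j) u = toTensorAlg L i s * toTensorAlg L j t := by
  have key : ∀ x, TensorPower.toTensorAlgebra
      (@GradedMonoid.GMul.mul _ (fun n => ⨂[ℂ]^n (L x)) _ _ _ _ (s x) (t x)) =
      TensorPower.toTensorAlgebra (s x) * TensorPower.toTensorAlgebra (t x) :=
    fun x => TensorPower.toTensorAlgebra_gMul _ _
  refine ⟨fun x => @GradedMonoid.GMul.mul _ (fun n => ⨂[ℂ]^n (L x)) _ _ _ _ (s x) (t x), ?_,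
    funext key⟩
  intro e _
  refine ((hs e).mul (ht e)).congr fun x _ => ?_
  simp only [tensorCoord_eq_lift, key, map_mul, Pi.mul_apply]

variable (L d) in
/-- The graded algebra `G(M, L) = ⨁_{i ≥ 1} H⁰(M, iL)` (without unit), realized inside the algebra
of families of elements of the tensor algebras `⨁ₖ L_x^{⊗k}`. -/
def sectionAlgebra : NonUnitalSubalgebra ℂ (∀ x, TensorAlgebra ℂ (L x)) where
  toSubmodule := ⨆ i : {i : ℕ // 1 ≤ i}, (H0 L d i).map (toTensorAlg L i)
  mul_mem' {a b} ha hb := by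
    simp only [AddSubsemigroup.mem_carrier, AddSubmonoid.mem_toSubsemigroup,
      Submodule.mem_toAddSubmonoid] at ha hb ⊢
    refine Submodule.iSup_induction _ (motive := fun a => a * b ∈ _) ha ?_ ?_ ?_
    · intro i a ha
      refine Submodule.iSup_induction _ (motive := fun b => a * b ∈ _) hb ?_ ?_ ?_
      · intro j b hb
        obtain ⟨s, hs, rfl⟩ := ha
        obtain ⟨t, ht, rfl⟩ := hb
        obtain ⟨u, hu, h⟩ := mul_mem_H0 L d hs ht
        rw [← h]
        exact Submodule.mem_iSup_of_mem (p := fun i : {i : ℕ // 1 ≤ i} =>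
          (H0 L d i).map (toTensorAlg L i)) ⟨i + j, le_add_right i.2⟩ ⟨u, hu, rfl⟩
      · simp
      · intro y z hy hz
        rw [mul_add]
        exact Submodule.add_mem _ hy hz
    · simp
    · intro y z hy hz
      rw [add_mul]
      exact Submodule.add_mem _ hy hz

variable (L d) in
/-- `L` is `r`-generated: the algebra `G(M, L)` is generated by the sections in
`H⁰(M, L), …, H⁰(M, rL)`. -/
def IsGenerated (r : ℕ) : Prop :=
  NonUnitalAlgebra.adjoin ℂ
    {a | ∃ i, 1 ≤ i ∧ i ≤ r ∧ ∃ s ∈ H0 L d i, a = toTensorAlg L i s} = sectionAlgebra L d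

variable (L d) in
/-- `kL` is spanned (base-point free): its global sections have no common zero. -/
def IsSpanned (k : ℕ) : Prop := ∀ x : M, ∃ s ∈ H0 L d k, s x ≠ 0

variable (L) in
/-- The map `x ↦ [s₀(x) : ⋯ : s_N(x)]` to `ℙᴺ` that sections `s₀, …, s_N` of `kL` without common
zero define. The ratios are taken in a trivialization of `L` around `x`, and their choice does not
matter, as the fibre of `kL` at `x` has dimension one. -/
def sectionMap {k N : ℕ} (s : Fin (N + 1) → ∀ x, ⨂[ℂ]^k (L x))
    (hs : ∀ x, ∃ j, s j x ≠ 0) (x : M) : ProjSpace N :=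
  ProjSpace.mk ⟨fun j => tensorCoord (trivializationAt ℂ L x) k x (s j x), fun h => by
    obtain ⟨j, hj⟩ := hs x
    exact hj (tensorCoord_injective _ k (mem_baseSet_trivializationAt ℂ L x)
      ((congrFun h j).trans (map_zero _).symm))⟩

variable (L d) in
/-- `kL` is very ample: some global sections `s₀, …, s_N` of `kL` without common zero define a
holomorphic embedding `[s₀ : ⋯ : s_N]` of `M` in `ℙᴺ`. -/
def IsVeryAmple (k : ℕ) : Prop :=
  ∃ (N : ℕ) (s : Fin (N + 1) → ∀ x, ⨂[ℂ]^k (L x)) (_ : ∀ j, s j ∈ H0 L d k)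
    (hs : ∀ x, ∃ j, s j x ≠ 0), IsHolomorphicEmbedding (d := d) (sectionMap L s hs)

variable (L d) in
/-- `L` is ample: some positive multiple of `L` is very ample. -/
def IsAmple : Prop := ∃ k : ℕ, 1 ≤ k ∧ IsVeryAmple L d k

end

end PolarizedManifold

end

/-! Let `s₀, …, sₙ` be sections of `kL` that embed `M`. As `L` is `r`-generated, each `s_j` is a
polynomial without constant term in a finite set `T` of sections of degrees at most `r`; as `L` is
spanned and `M` is compact, a finite set `U` of sections of `L` has no common zero. Lift everything
to degree `r`: the products `t u^(r-i)`, with `t ∈ T` of degree `i`, and the powers `u^r` define a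
map `[σ]` to projective space.

The ratios of the `σ_j` include `t u^(r-i) / u^r = t / u^i`. Where `u ≠ 0`, `[σ]` thus determines
the normalized values `t / u^i`, hence, by sums and products, the values `s_j / u^k`, hence `[s]`.
So two points with the same image under `[σ]` have the same image under `[s]`
(`ContainsProducts.injective`), and a tangent vector killed by the differential of `[σ]` is killed
by that of `[s]` (`ContainsProducts.mfderiv_eq_zero`). Both inductions over the generated algebra
rest on `coordEval`, an algebra homomorphism whose scaling parameter performs the division by powers
of `u`. Compactness of `M` and the Hausdorff property of projective space make the injective map
`[σ]` a topological embedding. -/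

noncomputable section

namespace PolarizedManifold

/-! ### Topology and charts of projective space -/

namespace ProjSpace

variable {n : ℕ}

/-- The set of points `[v₀ : ⋯ : vₙ]` with `|v_j| < |v_i|`. -/
def dominatedSet (i j : Fin (n + 1)) : Set (ProjSpace n) := mk '' {v | ‖v.1 j‖ < ‖v.1 i‖}

theorem mk_mem_dominatedSet (i j : Fin (n + 1)) (v : {v : Fin (n + 1) → ℂ // v ≠ 0}) :
    mk v ∈ dominatedSet i j ↔ ‖v.1 j‖ < ‖v.1 i‖ := by
  refine ⟨?_, fun h => ⟨v, h, rfl⟩⟩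
  rintro ⟨w, hw, h⟩
  obtain ⟨a, ha⟩ := (mk_eq_mk_iff w v).1 h
  have hw' : ‖w.1 j‖ < ‖w.1 i‖ := hw
  rw [← ha] at hw'
  simp only [Pi.smul_apply, smul_eq_mul, norm_mul] at hw'
  exact lt_of_mul_lt_mul_left hw' (norm_nonneg a)

theorem isOpen_dominatedSet (i j : Fin (n + 1)) : IsOpen (dominatedSet (n := n) i j) := by
  rw [← isQuotientMap_mk.isOpen_preimage]
  have : mk ⁻¹' dominatedSet (n := n) i j = {v | ‖v.1 j‖ < ‖v.1 i‖} := by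
    ext v; exact mk_mem_dominatedSet i j v
  rw [this]
  exact isOpen_lt ((continuous_apply j).comp continuous_subtype_val).norm
    ((continuous_apply i).comp continuous_subtype_val).norm

/-- Points in a common affine chart are separated there. Otherwise one has `v_i ≠ 0 = v_j` and the
other `w_j ≠ 0 = w_i`, and comparing `|v_i|` with `|v_j|` separates them. -/
instance : T2Space (ProjSpace n) := by
  refine ⟨fun p q hpq => ?_⟩
  obtain ⟨i, hi⟩ := exists_mem_affineSet p
  by_cases hqi : q ∈ affineSet i
  · have hne : affineChart i p ≠ affineChart i q := fun h =>
      hpq ((affineChart i).injOn hi hqi h)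
    obtain ⟨U, V, hU, hV, hpU, hqV, hUV⟩ := t2_separation hne
    refine ⟨_, _, (affineChart i).isOpen_inter_preimage hU,
      (affineChart i).isOpen_inter_preimage hV, ⟨hi, hpU⟩, ⟨hqi, hqV⟩, ?_⟩
    exact (hUV.preimage (affineChart i)).mono inter_subset_right inter_subset_right
  · obtain ⟨j, hj⟩ := exists_mem_affineSet q
    obtain ⟨v, rfl⟩ := mk_surjective p
    obtain ⟨w, rfl⟩ := mk_surjective q
    rw [mk_mem_affineSet] at hi hqi hj
    rw [not_not] at hqi
    by_cases hpj : v.1 j = 0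
    · refine ⟨_, _, isOpen_dominatedSet i j, isOpen_dominatedSet j i,
        (mk_mem_dominatedSet _ _ _).2 (by simpa [hpj] using hi),
        (mk_mem_dominatedSet _ _ _).2 (by simpa [hqi] using hj), ?_⟩
      rw [Set.disjoint_left]
      intro z hz hz'
      obtain ⟨u, rfl⟩ := mk_surjective z
      exact lt_asymm ((mk_mem_dominatedSet _ _ _).1 hz) ((mk_mem_dominatedSet _ _ _).1 hz')
    · have hp' : mk v ∈ affineSet j := (mk_mem_affineSet _ _).2 hpj
      have hq' : mk w ∈ affineSet j := (mk_mem_affineSet _ _).2 hj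
      have hne : affineChart j (mk v) ≠ affineChart j (mk w) := fun h =>
        hpq ((affineChart j).injOn hp' hq' h)
      obtain ⟨U, V, hU, hV, hpU, hqV, hUV⟩ := t2_separation hne
      refine ⟨_, _, (affineChart j).isOpen_inter_preimage hU,
        (affineChart j).isOpen_inter_preimage hV, ⟨hp', hpU⟩, ⟨hq', hqV⟩, ?_⟩
      exact (hUV.preimage (affineChart j)).mono inter_subset_right inter_subset_right

theorem affineChart_mem_maximalAtlas (i : Fin (n + 1)) :
    affineChart i ∈ IsManifold.maximalAtlas 𝓘(ℂ, Fin n → ℂ) ω (ProjSpace n) :=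
  IsManifold.subset_maximalAtlas (mem_range_self i)

theorem contMDiffAt_affineCoord {i : Fin (n + 1)} {p : ProjSpace n} (hp : p ∈ affineSet i) :
    ContMDiffAt 𝓘(ℂ, Fin n → ℂ) 𝓘(ℂ, Fin n → ℂ) ω (affineCoord i) p :=
  (contMDiffOn_of_mem_maximalAtlas (affineChart_mem_maximalAtlas i)).contMDiffAt
    ((isOpen_affineSet i).mem_nhds hp)

theorem contMDiff_ofAffine (i : Fin (n + 1)) :
    ContMDiff 𝓘(ℂ, Fin n → ℂ) 𝓘(ℂ, Fin n → ℂ) ω (ofAffine (n := n) i) :=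
  contMDiffOn_univ.1 (contMDiffOn_symm_of_mem_maximalAtlas (affineChart_mem_maximalAtlas i))

theorem ofAffine_affineCoord {i : Fin (n + 1)} {p : ProjSpace n} (hp : p ∈ affineSet i) :
    ofAffine i (affineCoord i p) = p :=
  (affineChart i).left_inv hp

end ProjSpace

/-! ### Functions that are stationary in a tangent direction -/

section Stationary

variable {d : ℕ} {M : Type*} [TopologicalSpace M] [ChartedSpace (EuclideanSpace ℂ (Fin d)) M]

/-- The function `f` is differentiable at `x`, and its derivative vanishes on `v`. -/
def IsStationaryAt (f : M → ℂ) (x : M) (v : TangentSpace 𝓘(ℂ, EuclideanSpace ℂ (Fin d)) x) :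
    Prop :=
  ∃ D : TangentSpace 𝓘(ℂ, EuclideanSpace ℂ (Fin d)) x →L[ℂ] ℂ,
    HasMFDerivAt 𝓘(ℂ, EuclideanSpace ℂ (Fin d)) 𝓘(ℂ, ℂ) f x D ∧ D v = 0

namespace IsStationaryAt

variable {f g : M → ℂ} {x : M} {v : TangentSpace 𝓘(ℂ, EuclideanSpace ℂ (Fin d)) x}

theorem congr (hf : IsStationaryAt f x v) (h : g =ᶠ[𝓝 x] f) : IsStationaryAt g x v := by
  obtain ⟨D, hD, h0⟩ := hf
  exact ⟨D, hD.congr_of_eventuallyEq h, h0⟩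

theorem const (c : ℂ) : IsStationaryAt (fun _ : M => c) x v :=
  ⟨0, hasMFDerivAt_const c x, rfl⟩

theorem add (hf : IsStationaryAt f x v) (hg : IsStationaryAt g x v) :
    IsStationaryAt (f + g) x v := by
  obtain ⟨D, hD, h0⟩ := hf
  obtain ⟨E, hE, h1⟩ := hg
  refine ⟨_, hD.add hE, ?_⟩
  change D v + E v = 0
  rw [h0, h1, add_zero]

/-- Leibniz rule. With sums and constants, this makes the functions stationary along `v` an algebra,
so stationarity passes from generators to the algebra that they generate. -/
theorem mul (hf : IsStationaryAt f x v) (hg : IsStationaryAt g x v) :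
    IsStationaryAt (f * g) x v := by
  obtain ⟨D, hD, h0⟩ := hf
  obtain ⟨E, hE, h1⟩ := hg
  refine ⟨_, hD.mul hE, ?_⟩
  change f x * E v + g x * D v = 0
  rw [h0, h1, mul_zero, mul_zero, add_zero]

theorem inv (hf : IsStationaryAt f x v) (hx : f x ≠ 0) : IsStationaryAt (f⁻¹) x v := by
  obtain ⟨D, hD, h0⟩ := hf
  refine ⟨_, hD.inv' hx, ?_⟩
  change -((f x)⁻¹ * D v * (f x)⁻¹) = 0
  rw [h0, mul_zero, zero_mul, neg_zero]

theorem div (hf : IsStationaryAt f x v) (hg : IsStationaryAt g x v) (hx : g x ≠ 0) :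
    IsStationaryAt (f / g) x v := by
  rw [div_eq_mul_inv]
  exact hf.mul (hg.inv hx)

end IsStationaryAt

end Stationary

/-! ### Evaluation of sections in a local trivialization -/

section Evaluation

variable {M : Type*} [TopologicalSpace M]
  {L : M → Type*} [∀ x, AddCommGroup (L x)] [∀ x, Module ℂ (L x)]
  [∀ x, TopologicalSpace (L x)] [TopologicalSpace (TotalSpace ℂ L)]
  [FiberBundle ℂ L]

/-- Evaluation at `x` of families of elements of the tensor algebras of the fibres of `L`, in the
linear coordinate `c • e` on the fibre at `x`. -/
def coordEval (e : Trivialization ℂ (π ℂ L)) [e.IsLinear ℂ] (c : ℂ) (x : M) :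
    (∀ x, TensorAlgebra ℂ (L x)) →ₐ[ℂ] ℂ :=
  (TensorAlgebra.lift ℂ (c • e.linearMapAt ℂ x)).comp
    (Pi.evalAlgHom ℂ (fun x => TensorAlgebra ℂ (L x)) x)

theorem lift_smul_toTensorAlgebra {V : Type*} [AddCommGroup V] [Module ℂ V] (f : V →ₗ[ℂ] ℂ)
    (c : ℂ) (k : ℕ) (a : ⨂[ℂ]^k V) :
    TensorAlgebra.lift ℂ (c • f) (TensorPower.toTensorAlgebra a) =
      c ^ k * TensorAlgebra.lift ℂ f (TensorPower.toTensorAlgebra a) := by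
  have h : (TensorAlgebra.lift ℂ (c • f)).toLinearMap ∘ₗ TensorPower.toTensorAlgebra =
      c ^ k • ((TensorAlgebra.lift ℂ f).toLinearMap ∘ₗ
        (TensorPower.toTensorAlgebra (n := k))) := by
    refine PiTensorProduct.ext (MultilinearMap.ext fun v => ?_)
    simp [TensorAlgebra.tprod_apply, List.prod_ofFn, List.map_ofFn, map_list_prod,
      Finset.prod_mul_distrib]
  exact LinearMap.congr_fun h a

/-- For `c = u(x)⁻¹`, with `u` of degree 1, a section `t` of degree `i` is sent to `t / u^i` at `x`,
while products and sums in mixed degrees are still respected. -/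
theorem coordEval_toTensorAlg (e : Trivialization ℂ (π ℂ L)) [e.IsLinear ℂ] (c : ℂ) (x : M)
    (k : ℕ) (s : ∀ x, ⨂[ℂ]^k (L x)) :
    coordEval e c x (toTensorAlg L k s) = c ^ k * tensorCoord e k x (s x) := by
  rw [tensorCoord_eq_lift, ← lift_smul_toTensorAlgebra]
  rfl

theorem coordEval_one_toTensorAlg (e : Trivialization ℂ (π ℂ L)) [e.IsLinear ℂ] (x : M)
    (k : ℕ) (s : ∀ x, ⨂[ℂ]^k (L x)) :
    coordEval e 1 x (toTensorAlg L k s) = tensorCoord e k x (s x) := by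
  rw [coordEval_toTensorAlg, one_pow, one_mul]

/-- The fibre is a line, spanned by the vector with `e`-coordinate 1; `g` is the `e'`-coordinate of
that vector. Outside the base set of `e'`, where `linearMapAt` is zero by default, `g = 0`. -/
theorem exists_linearMapAt_eq_smul (e e' : Trivialization ℂ (π ℂ L)) [e.IsLinear ℂ]
    [e'.IsLinear ℂ] {x : M} (hx : x ∈ e.baseSet) :
    ∃ g : ℂ, e'.linearMapAt ℂ x = g • e.linearMapAt ℂ x := by
  refine ⟨e'.linearMapAt ℂ x ((e.linearEquivAt ℂ x hx).symm 1), LinearMap.ext fun v => ?_⟩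
  have hv : v = (e.linearMapAt ℂ x v) • (e.linearEquivAt ℂ x hx).symm 1 := by
    apply (e.linearEquivAt ℂ x hx).injective
    simp [Trivialization.linearMapAt_apply, hx]
  conv_lhs => rw [hv]
  rw [map_smul, LinearMap.smul_apply, smul_eq_mul, smul_eq_mul, mul_comm]

theorem exists_tensorCoord_eq_mul (e e' : Trivialization ℂ (π ℂ L)) [e.IsLinear ℂ]
    [e'.IsLinear ℂ] (k : ℕ) {x : M} (hx : x ∈ e.baseSet) :
    ∃ g : ℂ, ∀ a, tensorCoord e' k x a = g * tensorCoord e k x a := by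
  obtain ⟨g, hg⟩ := exists_linearMapAt_eq_smul e e' hx
  refine ⟨g ^ k, fun a => ?_⟩
  rw [tensorCoord_eq_lift, tensorCoord_eq_lift, hg, lift_smul_toTensorAlgebra]

theorem tensorCoord_ne_zero (e : Trivialization ℂ (π ℂ L)) [e.IsLinear ℂ] (k : ℕ) {x : M}
    (hx : x ∈ e.baseSet) {a : ⨂[ℂ]^k (L x)} (ha : a ≠ 0) : tensorCoord e k x a ≠ 0 := fun h =>
  ha (tensorCoord_injective e k hx (h.trans (map_zero _).symm))

end Evaluation

/-! ### Maps to projective space given by sections -/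

section SectionMap

variable {M : Type*} [TopologicalSpace M]
  {L : M → Type*} [∀ x, AddCommGroup (L x)] [∀ x, Module ℂ (L x)]
  [∀ x, TopologicalSpace (L x)] [TopologicalSpace (TotalSpace ℂ L)]
  [FiberBundle ℂ L] [VectorBundle ℂ ℂ L]
  {d : ℕ} [ChartedSpace (EuclideanSpace ℂ (Fin d)) M]
  {k N : ℕ} {s : Fin (N + 1) → ∀ x, ⨂[ℂ]^k (L x)}

theorem contMDiffAt_tensorCoord {t : ∀ x, ⨂[ℂ]^k (L x)} (ht : t ∈ H0 L d k) (x : M) :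
    ContMDiffAt 𝓘(ℂ, EuclideanSpace ℂ (Fin d)) 𝓘(ℂ, ℂ) ω
      (fun y => tensorCoord (trivializationAt ℂ L x) k y (t y)) x :=
  (ht (trivializationAt ℂ L x)).contMDiffAt ((trivializationAt ℂ L x).open_baseSet.mem_nhds
    (mem_baseSet_trivializationAt ℂ L x))

theorem eventually_tensorCoord_ne_zero {t : ∀ x, ⨂[ℂ]^k (L x)} (ht : t ∈ H0 L d k) {x : M}
    (hx : t x ≠ 0) :
    ∀ᶠ y in 𝓝 x, tensorCoord (trivializationAt ℂ L x) k y (t y) ≠ 0 :=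
  (contMDiffAt_tensorCoord ht x).continuousAt.eventually_ne
    (tensorCoord_ne_zero _ k (mem_baseSet_trivializationAt ℂ L x) hx)

/-- `sectionMap` uses at each point `y` the trivialization chosen at `y`, which need not vary
continuously. The transition factor cancels in ratios, so one fixed `e` computes the map on its
whole base set. -/
theorem sectionMap_mem_affineSet_and_affineCoord (hs : ∀ x, ∃ j, s j x ≠ 0)
    (e : Trivialization ℂ (π ℂ L)) [e.IsLinear ℂ] {y : M} (hy : y ∈ e.baseSet)
    {i : Fin (N + 1)} (hi : tensorCoord e k y (s i y) ≠ 0) :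
    sectionMap L s hs y ∈ ProjSpace.affineSet i ∧
      ProjSpace.affineCoord i (sectionMap L s hs y) = fun j =>
        tensorCoord e k y (s (i.succAbove j) y) / tensorCoord e k y (s i y) := by
  obtain ⟨g, hg⟩ := exists_tensorCoord_eq_mul e (trivializationAt ℂ L y) k hy
  have hi' : tensorCoord (trivializationAt ℂ L y) k y (s i y) ≠ 0 :=
    tensorCoord_ne_zero _ k (mem_baseSet_trivializationAt ℂ L y) fun h => hi (by simp [h])
  have hg0 : g ≠ 0 := by
    rintro rfl
    exact hi' (by rw [hg, zero_mul])
  refine ⟨(ProjSpace.mk_mem_affineSet i _).2 hi', ?_⟩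
  rw [sectionMap, ProjSpace.affineCoord_mk]
  funext j
  simp only [hg]
  exact mul_div_mul_left _ _ hg0

theorem sectionMap_eventuallyEq (hs : ∀ x, ∃ j, s j x ≠ 0) (hH : ∀ j, s j ∈ H0 L d k) {x : M}
    {i : Fin (N + 1)} (hi : s i x ≠ 0) :
    sectionMap L s hs =ᶠ[𝓝 x] fun y => ProjSpace.ofAffine i fun j =>
      tensorCoord (trivializationAt ℂ L x) k y (s (i.succAbove j) y) /
        tensorCoord (trivializationAt ℂ L x) k y (s i y) := by
  filter_upwards [eventually_tensorCoord_ne_zero (hH i) hi,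
    (trivializationAt ℂ L x).open_baseSet.mem_nhds (mem_baseSet_trivializationAt ℂ L x)]
    with y hy hy'
  obtain ⟨h1, h2⟩ := sectionMap_mem_affineSet_and_affineCoord hs _ hy' hy
  rw [← h2, ProjSpace.ofAffine_affineCoord h1]

theorem contMDiffAt_ratio (hH : ∀ j, s j ∈ H0 L d k) {x : M} {i : Fin (N + 1)} (hi : s i x ≠ 0)
    (j : Fin (N + 1)) :
    ContMDiffAt 𝓘(ℂ, EuclideanSpace ℂ (Fin d)) 𝓘(ℂ, ℂ) ω (fun y =>
      tensorCoord (trivializationAt ℂ L x) k y (s j y) /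
        tensorCoord (trivializationAt ℂ L x) k y (s i y)) x :=
  (contMDiffAt_tensorCoord (hH j) x).div₀ (contMDiffAt_tensorCoord (hH i) x)
    (tensorCoord_ne_zero _ k (mem_baseSet_trivializationAt ℂ L x) hi)

theorem contMDiffAt_ratios (hH : ∀ j, s j ∈ H0 L d k) {x : M} {i : Fin (N + 1)}
    (hi : s i x ≠ 0) :
    ContMDiffAt 𝓘(ℂ, EuclideanSpace ℂ (Fin d)) 𝓘(ℂ, Fin N → ℂ) ω (fun y (j : Fin N) =>
      tensorCoord (trivializationAt ℂ L x) k y (s (i.succAbove j) y) /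
        tensorCoord (trivializationAt ℂ L x) k y (s i y)) x :=
  contMDiffAt_pi_space.2 fun _ => contMDiffAt_ratio hH hi _

theorem contMDiff_sectionMap (hs : ∀ x, ∃ j, s j x ≠ 0) (hH : ∀ j, s j ∈ H0 L d k) :
    ContMDiff 𝓘(ℂ, EuclideanSpace ℂ (Fin d)) 𝓘(ℂ, Fin N → ℂ) ω (sectionMap L s hs) := by
  intro x
  obtain ⟨i, hi⟩ := hs x
  exact ((ProjSpace.contMDiff_ofAffine i).contMDiffAt.comp x
    (contMDiffAt_ratios hH hi)).congr_of_eventuallyEq (sectionMap_eventuallyEq hs hH hi)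

/-- A tangent vector is in the kernel of the differential of `[s₀ : ⋯ : s_N]` if the ratios
`s_j / s_i` are stationary in its direction. -/
theorem mfderiv_sectionMap_eq_zero (hs : ∀ x, ∃ j, s j x ≠ 0) (hH : ∀ j, s j ∈ H0 L d k) {x : M}
    {i : Fin (N + 1)} (hi : s i x ≠ 0) {v : TangentSpace 𝓘(ℂ, EuclideanSpace ℂ (Fin d)) x}
    (hv : ∀ j, IsStationaryAt (fun y => tensorCoord (trivializationAt ℂ L x) k y (s j y) /
      tensorCoord (trivializationAt ℂ L x) k y (s i y)) x v) :
    mfderiv 𝓘(ℂ, EuclideanSpace ℂ (Fin d)) 𝓘(ℂ, Fin N → ℂ) (sectionMap L s hs) x v = 0 := by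
  have hR := (contMDiffAt_ratios hH hi).mdifferentiableAt (by simp)
  have h0 : mfderiv 𝓘(ℂ, EuclideanSpace ℂ (Fin d)) 𝓘(ℂ, Fin N → ℂ) (fun y (j : Fin N) =>
      tensorCoord (trivializationAt ℂ L x) k y (s (i.succAbove j) y) /
        tensorCoord (trivializationAt ℂ L x) k y (s i y)) x v = 0 := by
    funext j
    obtain ⟨D, hD, hDv⟩ := hv (i.succAbove j)
    have hp (w : Fin N → ℂ) : HasMFDerivAt 𝓘(ℂ, Fin N → ℂ) 𝓘(ℂ, ℂ) (fun w => w j) w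
        (ContinuousLinearMap.proj (R := ℂ) (φ := fun _ : Fin N => ℂ) j) :=
      (ContinuousLinearMap.proj (R := ℂ) (φ := fun _ : Fin N => ℂ) j).hasMFDerivAt
    have := hasMFDerivAt_unique hD ((hp _).comp x hR.hasMFDerivAt)
    rw [this] at hDv
    exact hDv
  rw [(sectionMap_eventuallyEq hs hH hi).mfderiv_eq]
  have hc := mfderiv_comp_apply (f := fun y (j : Fin N) =>
      tensorCoord (trivializationAt ℂ L x) k y (s (i.succAbove j) y) /
        tensorCoord (trivializationAt ℂ L x) k y (s i y)) x
    (((ProjSpace.contMDiff_ofAffine i).contMDiffAt).mdifferentiableAt (by simp)) hR v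
  exact (hc.trans (congrArg _ h0)).trans (map_zero _)

theorem isStationaryAt_ratio (hs : ∀ x, ∃ j, s j x ≠ 0) (hH : ∀ j, s j ∈ H0 L d k) {x : M}
    {i : Fin (N + 1)} (hi : s i x ≠ 0) {v : TangentSpace 𝓘(ℂ, EuclideanSpace ℂ (Fin d)) x}
    (hv : mfderiv 𝓘(ℂ, EuclideanSpace ℂ (Fin d)) 𝓘(ℂ, Fin N → ℂ) (sectionMap L s hs) x v = 0)
    (j : Fin (N + 1)) :
    IsStationaryAt (fun y => tensorCoord (trivializationAt ℂ L x) k y (s j y) /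
      tensorCoord (trivializationAt ℂ L x) k y (s i y)) x v := by
  have hne := eventually_tensorCoord_ne_zero (hH i) hi
  have hbase := (trivializationAt ℂ L x).open_baseSet.mem_nhds
    (mem_baseSet_trivializationAt ℂ L x)
  -- The ratio with `j = i` is the constant 1 near `x`; the others are affine coordinates of the
  -- map, to which the chain rule applies.
  rcases Fin.eq_self_or_eq_succAbove i j with rfl | ⟨l, rfl⟩
  · refine (IsStationaryAt.const 1).congr ?_
    filter_upwards [hne] with y hy using div_self hy
  · have hmem := (sectionMap_mem_affineSet_and_affineCoord hs _
      (mem_baseSet_trivializationAt ℂ L x) hne.self_of_nhds).1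
    have hA := (ProjSpace.contMDiffAt_affineCoord hmem).mdifferentiableAt (by simp)
    have hS := ((contMDiff_sectionMap hs hH) x).mdifferentiableAt (by simp)
    have hp : HasMFDerivAt 𝓘(ℂ, Fin N → ℂ) 𝓘(ℂ, ℂ) (fun w : Fin N → ℂ => w l)
        (ProjSpace.affineCoord i (sectionMap L s hs x))
        (ContinuousLinearMap.proj (R := ℂ) (φ := fun _ : Fin N => ℂ) l) :=
      (ContinuousLinearMap.proj (R := ℂ) (φ := fun _ : Fin N => ℂ) l).hasMFDerivAt
    obtain ⟨E, hE⟩ : ∃ E, HasMFDerivAt 𝓘(ℂ, Fin N → ℂ) 𝓘(ℂ, ℂ)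
        (fun p => ProjSpace.affineCoord i p l) (sectionMap L s hs x) E :=
      ⟨_, hp.comp _ hA.hasMFDerivAt⟩
    refine IsStationaryAt.congr
      ⟨_, hE.comp x hS.hasMFDerivAt, (congrArg E hv).trans (map_zero E)⟩ ?_
    filter_upwards [hne, hbase] with y hy hy'
    exact (congrFun (sectionMap_mem_affineSet_and_affineCoord hs _ hy' hy).2 l).symm

end SectionMap

/-! ### Products of sections -/

section Products

variable {M : Type*} [TopologicalSpace M]
  {L : M → Type*} [∀ x, AddCommGroup (L x)] [∀ x, Module ℂ (L x)]
  [∀ x, TopologicalSpace (L x)] [TopologicalSpace (TotalSpace ℂ L)]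
  [FiberBundle ℂ L] [VectorBundle ℂ ℂ L]
  {d : ℕ} [ChartedSpace (EuclideanSpace ℂ (Fin d)) M]

variable (L d) in
/-- The image of `H⁰(M, kL)` in the algebra of families of elements of the tensor algebras of the
fibres of `L`. -/
def homogeneousPart (k : ℕ) : Submodule ℂ (∀ x, TensorAlgebra ℂ (L x)) :=
  (H0 L d k).map (toTensorAlg L k)

theorem mul_mem_homogeneousPart {i j : ℕ} {a b : ∀ x, TensorAlgebra ℂ (L x)}
    (ha : a ∈ homogeneousPart L d i) (hb : b ∈ homogeneousPart L d j) :
    a * b ∈ homogeneousPart L d (i + j) := by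
  obtain ⟨s, hs, rfl⟩ := ha
  obtain ⟨t, ht, rfl⟩ := hb
  obtain ⟨u, hu, h⟩ := mul_mem_H0 L d hs ht
  exact ⟨u, hu, h⟩

/-- Degree 0 occurs as the factor `u^(r-i)` for a generator of top degree `i = r`. -/
theorem one_mem_homogeneousPart : (1 : ∀ x, TensorAlgebra ℂ (L x)) ∈ homogeneousPart L d 0 := by
  have key : ∀ x, TensorPower.toTensorAlgebra
      (@GradedMonoid.GOne.one _ (fun n => ⨂[ℂ]^n (L x)) _ _) = 1 :=
    fun x => TensorPower.toTensorAlgebra_gOne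
  refine ⟨fun x => @GradedMonoid.GOne.one _ (fun n => ⨂[ℂ]^n (L x)) _ _, ?_, funext key⟩
  intro e _
  simp only [tensorCoord_eq_lift, key, map_one]
  exact contMDiffOn_const

theorem pow_mem_homogeneousPart {b : ∀ x, TensorAlgebra ℂ (L x)}
    (hb : b ∈ homogeneousPart L d 1) (n : ℕ) : b ^ n ∈ homogeneousPart L d n := by
  induction n with
  | zero => rw [pow_zero]; exact one_mem_homogeneousPart
  | succ n ih => rw [pow_succ]; exact mul_mem_homogeneousPart ih hb

theorem coordEval_of_mem_homogeneousPart (e : Trivialization ℂ (π ℂ L)) [e.IsLinear ℂ] (c : ℂ)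
    (x : M) {k : ℕ} {a : ∀ x, TensorAlgebra ℂ (L x)} (ha : a ∈ homogeneousPart L d k) :
    coordEval e c x a = c ^ k * coordEval e 1 x a := by
  obtain ⟨s, -, rfl⟩ := ha
  rw [coordEval_toTensorAlg, coordEval_one_toTensorAlg]

theorem contMDiffAt_coordEval {k : ℕ} {a : ∀ x, TensorAlgebra ℂ (L x)}
    (ha : a ∈ homogeneousPart L d k) (x : M) :
    ContMDiffAt 𝓘(ℂ, EuclideanSpace ℂ (Fin d)) 𝓘(ℂ, ℂ) ω
      (fun y => coordEval (trivializationAt ℂ L x) 1 y a) x := by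
  obtain ⟨s, hs, rfl⟩ := ha
  simp only [coordEval_one_toTensorAlg]
  exact contMDiffAt_tensorCoord hs x

/-- On a compact manifold, a spanned line bundle has finitely many sections without common
zero. -/
theorem IsSpanned.exists_finite [CompactSpace M] (h : IsSpanned L d 1) :
    ∃ U : Set (∀ x, TensorAlgebra ℂ (L x)), U.Finite ∧ (∀ u ∈ U, u ∈ homogeneousPart L d 1) ∧
      ∀ x, ∃ u ∈ U, coordEval (trivializationAt ℂ L x) 1 x u ≠ 0 := by
  choose s hs hsx using h
  obtain ⟨F, -, hF⟩ := isCompact_univ.elim_nhds_subcover _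
    (fun x _ => eventually_tensorCoord_ne_zero (hs x) (hsx x))
  refine ⟨(fun x => toTensorAlg L 1 (s x)) '' F, F.finite_toSet.image _, ?_, fun y => ?_⟩
  · rintro _ ⟨x, -, rfl⟩
    exact ⟨s x, hs x, rfl⟩
  · obtain ⟨x, hx, hy⟩ := mem_iUnion₂.1 (hF (mem_univ y))
    refine ⟨_, ⟨x, hx, rfl⟩, ?_⟩
    rw [coordEval_one_toTensorAlg]
    -- The cover records nonvanishing in the trivialization at its centre `x`. This forces the
    -- section to be nonzero at `y`, hence also in the trivialization at `y`.
    refine tensorCoord_ne_zero _ 1 (mem_baseSet_trivializationAt ℂ L y) fun h0 => hy ?_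
    rw [h0, map_zero]

end Products

/-- A polynomial expression involves finitely many generators. This keeps the family `σ` finite
without finite-dimensionality of the spaces `H⁰(M, iL)`. -/
theorem exists_finite_subset_mem_adjoin {A : Type*} [Ring A] [Algebra ℂ A] {S : Set A} {a : A}
    (ha : a ∈ NonUnitalAlgebra.adjoin ℂ S) :
    ∃ T ⊆ S, T.Finite ∧ a ∈ NonUnitalAlgebra.adjoin ℂ T := by
  have hmono {T T' : Set A} (h : T ⊆ T') :
      NonUnitalAlgebra.adjoin ℂ T ≤ NonUnitalAlgebra.adjoin ℂ T' :=
    NonUnitalAlgebra.adjoin_mono h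
  induction ha using NonUnitalAlgebra.adjoin_induction with
  | mem x hx => exact ⟨{x}, by simpa using hx, finite_singleton x,
      NonUnitalAlgebra.subset_adjoin ℂ rfl⟩
  | zero => exact ⟨∅, empty_subset _, finite_empty, zero_mem _⟩
  | add x y _ _ hx hy =>
    obtain ⟨T, hT, hTf, hxT⟩ := hx
    obtain ⟨T', hT', hTf', hyT⟩ := hy
    exact ⟨T ∪ T', union_subset hT hT', hTf.union hTf',
      add_mem (hmono subset_union_left hxT) (hmono subset_union_right hyT)⟩
  | mul x y _ _ hx hy =>
    obtain ⟨T, hT, hTf, hxT⟩ := hx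
    obtain ⟨T', hT', hTf', hyT⟩ := hy
    exact ⟨T ∪ T', union_subset hT hT', hTf.union hTf',
      mul_mem (hmono subset_union_left hxT) (hmono subset_union_right hyT)⟩
  | smul c x _ hx =>
    obtain ⟨T, hT, hTf, hxT⟩ := hx
    exact ⟨T, hT, hTf, SMulMemClass.smul_mem c hxT⟩

/-! ### Separation of points and tangent vectors -/

section Separation

variable {M : Type*} [TopologicalSpace M]
  {L : M → Type*} [∀ x, AddCommGroup (L x)] [∀ x, Module ℂ (L x)]
  [∀ x, TopologicalSpace (L x)] [TopologicalSpace (TotalSpace ℂ L)]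
  [FiberBundle ℂ L] [VectorBundle ℂ ℂ L]
  {d : ℕ} [ChartedSpace (EuclideanSpace ℂ (Fin d)) M]

variable (d) in
/-- The products `t u^{r-i}`, for `t ∈ T` of some degree `i ≤ r` and `u ∈ U`, and the powers `u^r`
are among the sections `σ₀, …, σ_N` of `rL`. -/
structure ContainsProducts {r N : ℕ} (σ : Fin (N + 1) → ∀ x, ⨂[ℂ]^r (L x))
    (T U : Set (∀ x, TensorAlgebra ℂ (L x))) : Prop where
  mul_pow : ∀ t ∈ T, ∃ i ≤ r, t ∈ homogeneousPart L d i ∧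
    ∀ u ∈ U, ∃ j, toTensorAlg L r (σ j) = t * u ^ (r - i)
  pow : ∀ u ∈ U, ∃ j, toTensorAlg L r (σ j) = u ^ r

variable {r N k n : ℕ} {σ : Fin (N + 1) → ∀ x, ⨂[ℂ]^r (L x)}
  {T U : Set (∀ x, TensorAlgebra ℂ (L x))} {s : Fin (n + 1) → ∀ x, ⨂[ℂ]^k (L x)}

theorem ContainsProducts.exists_ne_zero (h : ContainsProducts d σ T U)
    (hU : ∀ x, ∃ u ∈ U, coordEval (trivializationAt ℂ L x) 1 x u ≠ 0) (x : M) :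
    ∃ j, σ j x ≠ 0 := by
  obtain ⟨u, hu, hux⟩ := hU x
  obtain ⟨j, hj⟩ := h.pow u hu
  refine ⟨j, fun h0 => pow_ne_zero r hux ?_⟩
  rw [← map_pow, ← hj, coordEval_one_toTensorAlg, h0, map_zero]

theorem ContainsProducts.injective (h : ContainsProducts d σ T U) (hr : 1 ≤ r)
    (hU : ∀ x, ∃ u ∈ U, coordEval (trivializationAt ℂ L x) 1 x u ≠ 0)
    (hσ : ∀ x, ∃ j, σ j x ≠ 0) (hs : ∀ x, ∃ j, s j x ≠ 0)
    (hsT : ∀ j, toTensorAlg L k (s j) ∈ NonUnitalAlgebra.adjoin ℂ T)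
    (hinj : Function.Injective (sectionMap L s hs)) :
    Function.Injective (sectionMap L σ hσ) := by
  intro x y hxy
  obtain ⟨a, ha⟩ := (ProjSpace.mk_eq_mk_iff _ _).1 hxy
  have ha' (j) : a * coordEval (trivializationAt ℂ L y) 1 y (toTensorAlg L r (σ j)) =
      coordEval (trivializationAt ℂ L x) 1 x (toTensorAlg L r (σ j)) := by
    rw [coordEval_one_toTensorAlg, coordEval_one_toTensorAlg]
    exact congrFun ha j
  obtain ⟨u, hu, hux⟩ := hU x
  set c := coordEval (trivializationAt ℂ L x) 1 x u with hc
  set c' := coordEval (trivializationAt ℂ L y) 1 y u with hc'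
  -- The section `u^r` ties the proportionality factor `a` to `u`. As `r ≥ 1`, it also shows that
  -- `u` does not vanish at `y`.
  have hcr : a * c' ^ r = c ^ r := by
    obtain ⟨j, hj⟩ := h.pow u hu
    simpa only [hj, map_pow] using ha' j
  have hc0 : c' ≠ 0 := by
    intro h0
    rw [h0, zero_pow (by omega), mul_zero] at hcr
    exact pow_ne_zero r hux hcr.symm
  -- In the coordinates that give `u` the value 1 at both points, evaluations at `x` and `y` agree
  -- on `T`, hence on the algebra it generates.
  have key : ∀ b ∈ NonUnitalAlgebra.adjoin ℂ T, coordEval (trivializationAt ℂ L x) c⁻¹ x b =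
      coordEval (trivializationAt ℂ L y) c'⁻¹ y b := by
    intro b hb
    induction hb using NonUnitalAlgebra.adjoin_induction with
    | mem t ht =>
      obtain ⟨i, hir, hi, hmul⟩ := h.mul_pow t ht
      obtain ⟨j, hj⟩ := hmul u hu
      have hj' := ha' j
      rw [hj, map_mul, map_mul, map_pow, map_pow, ← hc, ← hc'] at hj'
      rw [coordEval_of_mem_homogeneousPart _ c⁻¹ _ hi, coordEval_of_mem_homogeneousPart _ c'⁻¹ _ hi,
        inv_pow, inv_pow, inv_mul_eq_iff_eq_mul₀ (pow_ne_zero _ hux)]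
      refine mul_right_cancel₀ (pow_ne_zero (r - i) hux) ?_
      rw [← hj']
      have h1 : c ^ i * c ^ (r - i) = a * (c' ^ i * c' ^ (r - i)) := by
        rw [← pow_add, ← pow_add, Nat.add_sub_cancel' hir, hcr]
      have hci := pow_ne_zero i hc0
      rw [mul_right_comm, h1]
      field_simp
    | zero => simp
    | add b b' _ _ hb hb' => rw [map_add, map_add, hb, hb']
    | mul b b' _ _ hb hb' => rw [map_mul, map_mul, hb, hb']
    | smul z b _ hb => rw [map_smul, map_smul, hb]
  -- The sections `s_j` have degree `k`, so undoing the two normalizations gives the common factor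
  -- `(c / c')^k`.
  refine hinj ((ProjSpace.mk_eq_mk_iff _ _).2 ⟨c ^ k * c'⁻¹ ^ k, funext fun j => ?_⟩)
  have := key _ (hsT j)
  rw [coordEval_toTensorAlg, coordEval_toTensorAlg, inv_pow,
    inv_mul_eq_iff_eq_mul₀ (pow_ne_zero _ hux)] at this
  rw [Pi.smul_apply, smul_eq_mul, mul_assoc]
  exact this.symm

theorem ContainsProducts.mfderiv_eq_zero (h : ContainsProducts d σ T U)
    (hσH : ∀ j, σ j ∈ H0 L d r) (hsH : ∀ j, s j ∈ H0 L d k)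
    (hU1 : ∀ u ∈ U, u ∈ homogeneousPart L d 1)
    (hU : ∀ x, ∃ u ∈ U, coordEval (trivializationAt ℂ L x) 1 x u ≠ 0)
    (hσ : ∀ x, ∃ j, σ j x ≠ 0) (hs : ∀ x, ∃ j, s j x ≠ 0)
    (hsT : ∀ j, toTensorAlg L k (s j) ∈ NonUnitalAlgebra.adjoin ℂ T) {x : M}
    {v : TangentSpace 𝓘(ℂ, EuclideanSpace ℂ (Fin d)) x}
    (hv : mfderiv 𝓘(ℂ, EuclideanSpace ℂ (Fin d)) 𝓘(ℂ, Fin N → ℂ) (sectionMap L σ hσ) x v = 0) :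
    mfderiv 𝓘(ℂ, EuclideanSpace ℂ (Fin d)) 𝓘(ℂ, Fin n → ℂ) (sectionMap L s hs) x v = 0 := by
  obtain ⟨u, hu, hux⟩ := hU x
  have hne := (contMDiffAt_coordEval (hU1 u hu) x).continuousAt.eventually_ne hux
  obtain ⟨j₀, hj₀⟩ := h.pow u hu
  have hσ₀ : σ j₀ x ≠ 0 := fun h0 => pow_ne_zero r hux <| by
    rw [← map_pow, ← hj₀, coordEval_one_toTensorAlg, h0, map_zero]
  -- The scaling now varies with `y`, so that `u` has constant value 1 near `x`. A generator `t`
  -- becomes `t u^(r-i) / u^r`, a ratio of two of the `σ_j`.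
  have key : ∀ b ∈ NonUnitalAlgebra.adjoin ℂ T, IsStationaryAt (fun y =>
      coordEval (trivializationAt ℂ L x) (coordEval (trivializationAt ℂ L x) 1 y u)⁻¹ y b)
      x v := by
    intro b hb
    induction hb using NonUnitalAlgebra.adjoin_induction with
    | mem t ht =>
      obtain ⟨i, hir, hi, hmul⟩ := h.mul_pow t ht
      obtain ⟨j, hj⟩ := hmul u hu
      refine (isStationaryAt_ratio hσ hσH hσ₀ hv j).congr ?_
      filter_upwards [hne] with y hy
      rw [← coordEval_one_toTensorAlg, ← coordEval_one_toTensorAlg, hj, hj₀, map_mul, map_pow,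
        map_pow, coordEval_of_mem_homogeneousPart _ _ _ hi, eq_div_iff (pow_ne_zero r hy),
        inv_pow]
      obtain ⟨l, rfl⟩ := Nat.exists_eq_add_of_le hir
      rw [Nat.add_sub_cancel_left, pow_add]
      field_simp
    | zero => simpa only [map_zero] using IsStationaryAt.const 0
    | add b b' _ _ hb hb' => simp only [map_add]; exact hb.add hb'
    | mul b b' _ _ hb hb' => simp only [map_mul]; exact hb.mul hb'
    | smul z b _ hb =>
      simp only [map_smul]
      exact (IsStationaryAt.const z).mul hb
  obtain ⟨i, hi⟩ := hs x
  refine mfderiv_sectionMap_eq_zero hs hsH hi fun j => ?_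
  -- Near `x`, `s_j / s_i` is the quotient of `s_j / u^k` by `s_i / u^k`.
  refine ((key _ (hsT j)).div (key _ (hsT i)) ?_).congr ?_
  · rw [coordEval_toTensorAlg]
    exact mul_ne_zero (pow_ne_zero k (inv_ne_zero hux))
      (tensorCoord_ne_zero _ k (mem_baseSet_trivializationAt ℂ L x) hi)
  · filter_upwards [hne] with y hy
    rw [Pi.div_apply, coordEval_toTensorAlg, coordEval_toTensorAlg,
      mul_div_mul_left _ _ (pow_ne_zero k (inv_ne_zero hy))]

theorem exists_containsProducts (hT : T.Finite) (hU : U.Finite)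
    (hTr : ∀ t ∈ T, ∃ i ≤ r, t ∈ homogeneousPart L d i)
    (hU1 : ∀ u ∈ U, u ∈ homogeneousPart L d 1) :
    ∃ (N : ℕ) (σ : Fin (N + 1) → ∀ x, ⨂[ℂ]^r (L x)), (∀ j, σ j ∈ H0 L d r) ∧
      ContainsProducts d σ T U := by
  let F : Set (∀ x, TensorAlgebra ℂ (L x)) :=
    (⋃ i ∈ Iic r, image2 (fun t u => t * u ^ (r - i)) (T ∩ homogeneousPart L d i) U) ∪
      (fun u => u ^ r) '' U
  have hF : F.Finite := ((finite_Iic r).biUnion fun i _ =>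
    (hT.subset inter_subset_left).image2 _ hU).union (hU.image _)
  have hFr : ∀ a ∈ F, a ∈ homogeneousPart L d r := by
    rintro a (ha | ⟨u, hu, rfl⟩)
    · obtain ⟨i, hi, t, ht, u, hu, rfl⟩ := mem_iUnion₂.1 ha
      have := mul_mem_homogeneousPart ht.2 (pow_mem_homogeneousPart (hU1 u hu) (r - i))
      rwa [Nat.add_sub_cancel' hi] at this
    · exact pow_mem_homogeneousPart (hU1 u hu) r
  obtain ⟨N, f, -, hf⟩ := hF.fin_param
  have hfr (j) : f j ∈ homogeneousPart L d r := hFr _ (hf ▸ mem_range_self j)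
  choose σ hσ hσf using hfr
  -- The zero section pads the family to `N + 1` members, so that an empty `F` is allowed.
  have hmem : ∀ a ∈ F, ∃ j, toTensorAlg L r
      ((Fin.cons 0 σ : Fin (N + 1) → ∀ x, ⨂[ℂ]^r (L x)) j) = a := by
    intro a ha
    rw [← hf] at ha
    obtain ⟨j, rfl⟩ := ha
    exact ⟨j.succ, hσf j⟩
  refine ⟨N, Fin.cons 0 σ, fun j => ?_, fun t ht => ?_, fun u hu => ?_⟩
  · refine Fin.cases (zero_mem _) (fun j => ?_) j
    exact hσ j
  · obtain ⟨i, hir, hi⟩ := hTr t ht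
    exact ⟨i, hir, hi, fun u hu =>
      hmem _ (Or.inl (mem_iUnion₂.2 ⟨i, hir, t, ⟨ht, hi⟩, u, hu, rfl⟩))⟩
  · exact hmem _ (Or.inr ⟨u, hu, rfl⟩)

end Separation

/-- If `L` is ample, spanned and `r`-generated, then `rL` is very ample. -/
theorem IsVeryAmple.of_isGenerated {d : ℕ} {M : Type*} [TopologicalSpace M] [CompactSpace M]
    [ChartedSpace (EuclideanSpace ℂ (Fin d)) M]
    {L : M → Type*} [∀ x, AddCommGroup (L x)] [∀ x, Module ℂ (L x)]
    [∀ x, TopologicalSpace (L x)] [TopologicalSpace (TotalSpace ℂ L)]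
    [FiberBundle ℂ L] [VectorBundle ℂ ℂ L]
    (hample : IsAmple L d) (hspanned : IsSpanned L d 1) {r : ℕ} (hr : 1 ≤ r)
    (hgen : IsGenerated L d r) : IsVeryAmple L d r := by
  obtain ⟨k, hk, n, s, hsH, hs, hemb⟩ := hample
  obtain ⟨U, hUf, hU1, hU⟩ := hspanned.exists_finite
  have hsA (j) : toTensorAlg L k (s j) ∈ NonUnitalAlgebra.adjoin ℂ
      {a | ∃ i, 1 ≤ i ∧ i ≤ r ∧ ∃ s ∈ H0 L d i, a = toTensorAlg L i s} := by
    rw [show NonUnitalAlgebra.adjoin ℂ _ = _ from hgen]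
    exact Submodule.mem_iSup_of_mem (p := fun i : {i : ℕ // 1 ≤ i} =>
      (H0 L d i).map (toTensorAlg L i)) ⟨k, hk⟩ ⟨s j, hsH j, rfl⟩
  choose T hTS hTf hsT using fun j => exists_finite_subset_mem_adjoin (hsA j)
  have hT : ∀ t ∈ ⋃ j, T j, ∃ i ≤ r, t ∈ homogeneousPart L d i := by
    intro t ht
    obtain ⟨j, hj⟩ := mem_iUnion.1 ht
    obtain ⟨i, -, hir, τ, hτ, rfl⟩ := hTS j hj
    exact ⟨i, hir, τ, hτ, rfl⟩
  obtain ⟨N, σ, hσH, hprod⟩ := exists_containsProducts (finite_iUnion hTf) hUf hT hU1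
  have hσ := hprod.exists_ne_zero hU
  have hsT' (j) : toTensorAlg L k (s j) ∈ NonUnitalAlgebra.adjoin ℂ (⋃ j, T j) :=
    NonUnitalAlgebra.adjoin_mono (subset_iUnion T j) (hsT j)
  have hsm := contMDiff_sectionMap hσ hσH
  refine ⟨N, σ, hσH, hσ, hsm, ?_, fun x => ?_⟩
  -- A continuous injection of a compact space into a Hausdorff space is a closed embedding.
  · exact (hsm.continuous.isClosedEmbedding
      (hprod.injective hr hU hσ hs hsT' hemb.isEmbedding.injective)).isEmbedding
  · refine (injective_iff_map_eq_zero _).2 fun v hv => ?_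
    refine (injective_iff_map_eq_zero _).1 (hemb.immersion x) v ?_
    exact hprod.mfderiv_eq_zero hσH hsH hU1 hU hσ hs hsT' hv

end PolarizedManifold

end

theorem mainTheorem4 {d : ℕ}
    {M : Type*} [TopologicalSpace M] [T2Space M] [CompactSpace M]
    [ChartedSpace (EuclideanSpace ℂ (Fin d)) M]
    [IsManifold 𝓘(ℂ, EuclideanSpace ℂ (Fin d)) ω M]
    (L : M → Type*) [∀ x, AddCommGroup (L x)] [∀ x, Module ℂ (L x)]
    [∀ x, TopologicalSpace (L x)] [TopologicalSpace (TotalSpace ℂ L)]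
    [FiberBundle ℂ L] [VectorBundle ℂ ℂ L]
    [ContMDiffVectorBundle ω ℂ L 𝓘(ℂ, EuclideanSpace ℂ (Fin d))]
    (hample : PolarizedManifold.IsAmple L d)
    (hspanned : PolarizedManifold.IsSpanned L d 1)
    (r : ℕ) (hr : 1 ≤ r) (hgen : PolarizedManifold.IsGenerated L d r) :
    PolarizedManifold.IsVeryAmple L d r :=
  PolarizedManifold.IsVeryAmple.of_isGenerated hample hspanned hr hgen
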